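/- Let $\alpha>-1$, let $H$ be a nonzero separable complex Hilbert space, and let $\mathbb{D}=\{z\in\mathbb{C}:|z|<1\}$. Let $\mathcal{A}^2_\alpha(H)$ be the weighted Bergman space of all analytic functions $f:\mathbb{D}\to H$ with $\int_{\mathbb{D}}\|f(z)\|^2\,dA_\alpha(z)<\infty$, where $dA_\alpha(z)=(\alpha+1)(1-|z|^2)^\alpha\,dA(z)$ and $dA$ is the area measure divided by $\pi$; it is a Hilbert space with inner product $\langle f,g\rangle=\int_{\mathbb{D}}\langle f(z),g(z)\rangle\,dA_\alpha(z)$. Let $\Phi:\mathbb{D}\to\mathbb{D}$ be analytic. Then the composition operator $C_\Phi f=f\circ\Phi$ is a normal operator on $\mathcal{A}^2_\alpha(H)$ (that is, $C_\Phi$ is a bounded linear operator on $\mathcal{A}^2_\alpha(H)$ and $C_\Phi^*C_\Phi=C_\Phi C_\Phi^*$) if and only if there is $\lambda\in\mathbb{C}$ with $|\lambda|\le 1$ such that $\Phi(z)=\lambda z$ for all $z\in\mathbb{D}$. -/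

import Mathlib

open MeasureTheory Filter Topology

/-- The open unit disk `𝔻` of the complex plane. -/
abbrev unitDisk : Set ℂ := Metric.ball (0 : ℂ) 1

/-- A function on the unit disk is analytic: it is (the restriction to `𝔻` of) a function that has
a convergent power series expansion around every point of `𝔻`. -/
def IsAnalyticOnDisk {X : Type*} [NormedAddCommGroup X] [NormedSpace ℂ X]
    (f : unitDisk → X) : Prop :=
  ∃ F : ℂ → X, AnalyticOnNhd ℂ F unitDisk ∧ ∀ z : unitDisk, F z = f z

/-- The measure `dA_α(z) = (α + 1) (1 - |z|²)^α dA(z)` on the unit disk, where `dA` is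
the area measure divided by `π`. -/
noncomputable def diskMeasure (α : ℝ) : Measure unitDisk :=
  (Measure.comap (fun z : unitDisk => (z : ℂ)) volume).withDensity
    (fun z => ENNReal.ofReal ((α + 1) * (1 - ‖(z : ℂ)‖ ^ 2) ^ α / Real.pi))

theorem IsAnalyticOnDisk.continuous {X : Type*} [NormedAddCommGroup X] [NormedSpace ℂ X]
    {f : unitDisk → X} (hf : IsAnalyticOnDisk f) : Continuous f := by
  obtain ⟨F, hF, hFf⟩ := hf
  have h := hF.continuousOn.domRestrict
  convert h using 1
  funext z
  exact (hFf z).symm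

/-- The analytic functions `f : 𝔻 → H` with `∫ ‖f‖² dA_α < ∞`, as a space of functions. -/
def bergmanSubmodule (α : ℝ) (H : Type*) [NormedAddCommGroup H] [InnerProductSpace ℂ H] :
    Submodule ℂ (unitDisk → H) where
  carrier := {f | IsAnalyticOnDisk f ∧ MemLp f 2 (diskMeasure α)}
  add_mem' := by
    rintro f g ⟨⟨F, hF, hFf⟩, hf⟩ ⟨⟨G, hG, hGg⟩, hg⟩
    exact ⟨⟨F + G, hF.add hG, fun z => by simp [hFf, hGg]⟩, hf.add hg⟩
  zero_mem' := ⟨⟨0, analyticOnNhd_const, fun z => rfl⟩, MemLp.zero⟩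
  smul_mem' := by
    rintro c f ⟨⟨F, hF, hFf⟩, hf⟩
    exact ⟨⟨c • F, analyticOnNhd_const.smul hF, fun z => by simp [hFf]⟩, hf.const_smul c⟩

/-- The vector-valued weighted Bergman space `A²_α(H)`. -/
def BergmanSpace (α : ℝ) (H : Type*) [NormedAddCommGroup H] [InnerProductSpace ℂ H] : Type _ :=
  bergmanSubmodule α H

namespace BergmanSpace

section Algebra

variable {α : ℝ} {H : Type*} [NormedAddCommGroup H] [InnerProductSpace ℂ H]

noncomputable instance : AddCommGroup (BergmanSpace α H) :=
  inferInstanceAs (AddCommGroup (bergmanSubmodule α H))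

noncomputable instance : Module ℂ (BergmanSpace α H) :=
  inferInstanceAs (Module ℂ (bergmanSubmodule α H))

/-- Elements of the Bergman space are functions on the unit disk. -/
instance : FunLike (BergmanSpace α H) unitDisk H where
  coe f := f.1
  coe_injective := Subtype.val_injective

theorem analytic (f : BergmanSpace α H) : IsAnalyticOnDisk (f : unitDisk → H) := f.2.1

theorem memLp (f : BergmanSpace α H) : MemLp (f : unitDisk → H) 2 (diskMeasure α) := f.2.2

theorem add_apply (f g : BergmanSpace α H) (z : unitDisk) : (f + g) z = f z + g z := rfl

theorem sub_apply (f g : BergmanSpace α H) (z : unitDisk) : (f - g) z = f z - g z := rfl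

theorem smul_apply (c : ℂ) (f : BergmanSpace α H) (z : unitDisk) : (c • f) z = c • f z := rfl

end Algebra

end BergmanSpace

theorem density_pos {α : ℝ} (hα : -1 < α) (z : unitDisk) :
    0 < (α + 1) * (1 - ‖(z : ℂ)‖ ^ 2) ^ α / Real.pi := by
  have hz : ‖(z : ℂ)‖ < 1 := mem_ball_zero_iff.1 z.2
  have h1 : 0 < 1 - ‖(z : ℂ)‖ ^ 2 := by nlinarith [norm_nonneg (z : ℂ)]
  have h2 : 0 < (1 - ‖(z : ℂ)‖ ^ 2) ^ α := Real.rpow_pos_of_pos h1 α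
  have h3 : 0 < α + 1 := by linarith
  have := Real.pi_pos
  positivity

theorem density_measurable (α : ℝ) : Measurable
    (fun z : unitDisk => ENNReal.ofReal ((α + 1) * (1 - ‖(z : ℂ)‖ ^ 2) ^ α / Real.pi)) := by
  fun_prop

theorem measurableEmbedding_disk : MeasurableEmbedding (fun z : unitDisk => (z : ℂ)) :=
  MeasurableEmbedding.subtype_coe Metric.isOpen_ball.measurableSet

theorem comap_pos_of_isOpen {U : Set unitDisk} (hU : IsOpen U) (hne : U.Nonempty) :
    Measure.comap (fun z : unitDisk => (z : ℂ)) volume U ≠ 0 := by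
  rw [measurableEmbedding_disk.comap_apply]
  have : IsOpen ((fun z : unitDisk => (z : ℂ)) '' U) :=
    (Metric.isOpen_ball.isOpenEmbedding_subtypeVal).isOpenMap U hU
  exact (this.measure_pos volume (hne.image _)).ne'

theorem isOpenPosMeasure_diskMeasure {α : ℝ} (hα : -1 < α) :
    (diskMeasure α).IsOpenPosMeasure := by
  constructor
  intro U hU hne h0
  unfold diskMeasure at h0
  rw [withDensity_apply_eq_zero (density_measurable α)] at h0
  refine comap_pos_of_isOpen hU hne ?_
  convert h0 using 2
  symm
  rw [Set.inter_eq_right]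
  intro z _
  simpa using density_pos hα z

namespace BergmanSpace

section Inner

variable {α : ℝ} {H : Type*} [NormedAddCommGroup H] [InnerProductSpace ℂ H]

theorem integrable_inner (f g : BergmanSpace α H) :
    Integrable (fun z => inner ℂ (f z) (g z)) (diskMeasure α) := by
  have h := L2.integrable_inner (𝕜 := ℂ) f.memLp.toLp g.memLp.toLp
  refine h.congr ?_
  filter_upwards [f.memLp.coeFn_toLp, g.memLp.coeFn_toLp] with z hf hg
  rw [hf, hg]

theorem integral_inner_self (f : BergmanSpace α H) :
    ∫ z, inner ℂ (f z) (f z) ∂(diskMeasure α) =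
      ((∫ z, ‖f z‖ ^ 2 ∂(diskMeasure α) : ℝ) : ℂ) := by
  have h : ∀ z, inner ℂ (f z) (f z) = ((‖f z‖ ^ 2 : ℝ) : ℂ) := fun z => by
    rw [inner_self_eq_norm_sq_to_K]
    simp
  simp only [h]
  exact integral_ofReal

/-- The inner product `⟪f, g⟫ = ∫ ⟪f z, g z⟫ dA_α(z)` (conjugate linear in the first variable,
as everywhere in Mathlib). -/
@[reducible]
noncomputable def core (α : ℝ) [hα : Fact (-1 < α)] (H : Type*) [NormedAddCommGroup H]
    [InnerProductSpace ℂ H] : InnerProductSpace.Core ℂ (BergmanSpace α H) where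
  inner f g := ∫ z, inner ℂ (f z) (g z) ∂(diskMeasure α)
  conj_inner_symm f g := by
    rw [← integral_conj]
    simp [inner_conj_symm]
  re_inner_nonneg f := by
    rw [integral_inner_self]
    simpa using integral_nonneg (fun z => by positivity)
  add_left f g h := by
    simp only [add_apply, inner_add_left]
    exact integral_add (integrable_inner f h) (integrable_inner g h)
  smul_left f g c := by
    simp only [smul_apply, inner_smul_left]
    exact integral_const_mul _ _
  definite f hf := by
    rw [integral_inner_self] at hf
    have h0 : ∫ z, ‖f z‖ ^ 2 ∂(diskMeasure α) = 0 := by exact_mod_cast hf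
    have hc : Continuous f := f.analytic.continuous
    have hint : Integrable (fun z => ‖f z‖ ^ 2) (diskMeasure α) :=
      (memLp_two_iff_integrable_sq_norm f.memLp.1).1 f.memLp
    rw [integral_eq_zero_iff_of_nonneg (fun z => by positivity) hint] at h0
    have := isOpenPosMeasure_diskMeasure hα.out
    have h1 := Continuous.ae_eq_iff_eq (diskMeasure α) (hc.norm.pow 2) continuous_const |>.1 h0
    apply DFunLike.ext
    intro z
    have h2 : ‖f z‖ ^ 2 = 0 := congrFun h1 z
    exact norm_eq_zero.1 (pow_eq_zero_iff two_ne_zero |>.1 h2)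

noncomputable instance [Fact (-1 < α)] : NormedAddCommGroup (BergmanSpace α H) :=
  (core α H).toNormedAddCommGroup

noncomputable instance [Fact (-1 < α)] : InnerProductSpace ℂ (BergmanSpace α H) :=
  InnerProductSpace.ofCore (core α H).toCore

theorem inner_def [Fact (-1 < α)] (f g : BergmanSpace α H) :
    inner ℂ f g = ∫ z, inner ℂ (f z) (g z) ∂(diskMeasure α) := rfl

theorem norm_sq_eq [Fact (-1 < α)] (f : BergmanSpace α H) :
    ‖f‖ ^ 2 = ∫ z, ‖f z‖ ^ 2 ∂(diskMeasure α) := by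
  have h := inner_self_eq_norm_sq_to_K (𝕜 := ℂ) f
  rw [inner_def, integral_inner_self] at h
  exact (Complex.ofReal_injective (h.trans (by simp))).symm

end Inner

end BergmanSpace

/-- The value of an analytic function is bounded by the mean of its norm over a circle. -/
theorem enorm_le_lintegral_circle {H : Type*} [NormedAddCommGroup H] [NormedSpace ℂ H]
    [CompleteSpace H] {F : ℂ → H} {z : ℂ} {r : ℝ} (hr : 0 < r)
    (hF : DifferentiableOn ℂ F (Metric.closedBall z r)) :
    ENNReal.ofReal (2 * Real.pi) * ‖F z‖ₑ ≤
      ∫⁻ θ in Set.Ioo (-Real.pi) Real.pi, ‖F (circleMap z r θ)‖ₑ := by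
  have hpi := Real.pi_pos
  have h1 : DiffContOnCl ℂ F (Metric.ball z |r|) := by
    rw [abs_of_pos hr]
    exact hF.diffContOnCl_ball subset_rfl
  have h2 := h1.circleAverage
  rw [Real.circleAverage_eq_integral_add (-Real.pi),
    intervalIntegral.integral_comp_add_right (fun θ => F (circleMap z r θ))] at h2
  have e1 : 0 + -Real.pi = -Real.pi := by ring
  have e2 : 2 * Real.pi + -Real.pi = Real.pi := by ring
  rw [e1, e2] at h2
  have h3 : (2 * Real.pi) • F z = ∫ θ in (-Real.pi)..Real.pi, F (circleMap z r θ) := by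
    rw [← h2, smul_smul, mul_inv_cancel₀ (by positivity), one_smul]
  have h4 : ENNReal.ofReal (2 * Real.pi) * ‖F z‖ₑ = ‖(2 * Real.pi) • F z‖ₑ := by
    rw [enorm_smul, Real.enorm_of_nonneg (by positivity)]
  rw [h4, h3, intervalIntegral.integral_of_le (by linarith), ← restrict_Ioo_eq_restrict_Ioc]
  exact enorm_integral_le_lintegral_enorm _

/-- The value of an analytic function is bounded by the integral of its norm over a disk. -/
theorem enorm_le_lintegral_ball {H : Type*} [NormedAddCommGroup H] [NormedSpace ℂ H]
    [CompleteSpace H] {F : ℂ → H} {z : ℂ} {ρ : ℝ}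
    (hF : DifferentiableOn ℂ F (Metric.closedBall z ρ)) :
    ENNReal.ofReal (ρ / 2) * ENNReal.ofReal (2 * Real.pi) * ENNReal.ofReal (ρ / 2) * ‖F z‖ₑ ≤
      ∫⁻ w in Metric.ball z ρ, ‖F w‖ₑ := by
  rcases le_or_gt ρ 0 with hρ | hρ
  · rw [ENNReal.ofReal_of_nonpos (by linarith : ρ / 2 ≤ 0)]
    simp
  set G : ℂ → ENNReal := fun w => (Metric.ball z ρ).indicator (fun w => ‖F w‖ₑ) (z + w) with hG
  have hpolar : ∀ r θ : ℝ, z + Complex.polarCoord.symm (r, θ) = circleMap z r θ := fun r θ => by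
    rw [Complex.polarCoord_symm_apply, circleMap, Complex.exp_mul_I]
    push_cast
    rfl
  have hmem : ∀ r θ : ℝ, 0 < r → r < ρ → circleMap z r θ ∈ Metric.ball z ρ := fun r θ h0 h => by
    rw [Metric.mem_ball, dist_eq_norm, circleMap_sub_center, norm_circleMap_zero, abs_of_pos h0]
    exact h
  have hcont : ContinuousOn (fun p : ℝ × ℝ => ENNReal.ofReal p.1 * ‖F (circleMap z p.1 p.2)‖ₑ)
      (Set.Ioo (ρ / 2) ρ ×ˢ Set.Ioo (-Real.pi) Real.pi) := by
    refine ENNReal.continuous_ofReal.comp_continuousOn continuousOn_fst |>.ennreal_mul ?_ ?_ ?_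
    · refine (hF.continuousOn.comp (t := Metric.closedBall z ρ) ?_ ?_).enorm
      · have : Continuous (fun p : ℝ × ℝ => circleMap z p.1 p.2) := by
          unfold circleMap
          fun_prop
        exact this.continuousOn
      · intro p hp
        have hp' : ρ / 2 < p.1 ∧ p.1 < ρ := hp.1
        exact Metric.ball_subset_closedBall (hmem _ _ (by linarith [hp'.1]) hp'.2)
    · intro p _
      right
      exact enorm_ne_top
    · intro p _
      right
      exact ENNReal.ofReal_ne_top
  calc ENNReal.ofReal (ρ / 2) * ENNReal.ofReal (2 * Real.pi) * ENNReal.ofReal (ρ / 2) * ‖F z‖ₑ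
      = ∫⁻ _ in Set.Ioo (ρ / 2) ρ,
          ENNReal.ofReal (ρ / 2) * (ENNReal.ofReal (2 * Real.pi) * ‖F z‖ₑ) := by
        rw [setLIntegral_const, Real.volume_Ioo, show ρ - ρ / 2 = ρ / 2 by ring]
        ring
    _ ≤ ∫⁻ r in Set.Ioo (ρ / 2) ρ, ∫⁻ θ in Set.Ioo (-Real.pi) Real.pi,
          ENNReal.ofReal r * ‖F (circleMap z r θ)‖ₑ := by
        refine setLIntegral_mono' measurableSet_Ioo (fun r hr => ?_)
        rw [lintegral_const_mul' _ _ ENNReal.ofReal_ne_top]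
        refine mul_le_mul' (ENNReal.ofReal_le_ofReal hr.1.le)
          (enorm_le_lintegral_circle (by linarith [hr.1])
            (hF.mono (Metric.closedBall_subset_closedBall hr.2.le)))
    _ = ∫⁻ p in Set.Ioo (ρ / 2) ρ ×ˢ Set.Ioo (-Real.pi) Real.pi,
          ENNReal.ofReal p.1 * ‖F (circleMap z p.1 p.2)‖ₑ := by
        rw [Measure.volume_eq_prod, setLIntegral_prod]
        exact hcont.aemeasurable (measurableSet_Ioo.prod measurableSet_Ioo)
    _ = ∫⁻ p in Set.Ioo (ρ / 2) ρ ×ˢ Set.Ioo (-Real.pi) Real.pi,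
          ENNReal.ofReal p.1 • G (Complex.polarCoord.symm p) := by
        refine setLIntegral_congr_fun (measurableSet_Ioo.prod measurableSet_Ioo) (fun p hp => ?_)
        obtain ⟨r, θ⟩ := p
        have hp' : ρ / 2 < r ∧ r < ρ := hp.1
        simp only [hG, hpolar, smul_eq_mul]
        rw [Set.indicator_of_mem (hmem r θ (by linarith [hp'.1]) hp'.2)]
    _ ≤ ∫⁻ p in polarCoord.target, ENNReal.ofReal p.1 • G (Complex.polarCoord.symm p) := by
        refine lintegral_mono_set ?_
        rintro ⟨r, θ⟩ ⟨h1, h2⟩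
        exact ⟨lt_trans (by linarith) h1.1, h2⟩
    _ = ∫⁻ w, G w := Complex.lintegral_comp_polarCoord_symm G
    _ = ∫⁻ w, (Metric.ball z ρ).indicator (fun w => ‖F w‖ₑ) w :=
        lintegral_add_left_eq_self (μ := volume)
          (fun w => (Metric.ball z ρ).indicator (fun w => ‖F w‖ₑ) w) z
    _ = ∫⁻ w in Metric.ball z ρ, ‖F w‖ₑ := lintegral_indicator Metric.isOpen_ball.measurableSet _

namespace BergmanSpace

section Complete

variable {α : ℝ} {H : Type*} [NormedAddCommGroup H] [InnerProductSpace ℂ H]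

theorem lintegral_sq_eq [Fact (-1 < α)] (f : BergmanSpace α H) :
    ∫⁻ z, ‖f z‖ₑ ^ 2 ∂(diskMeasure α) = ENNReal.ofReal (‖f‖ ^ 2) := by
  have hint : Integrable (fun z => ‖f z‖ ^ 2) (diskMeasure α) :=
    (memLp_two_iff_integrable_sq_norm f.memLp.1).1 f.memLp
  rw [norm_sq_eq, ofReal_integral_eq_lintegral_ofReal hint
    (Eventually.of_forall fun z => by positivity)]
  congr 1
  funext z
  rw [ENNReal.ofReal_pow (norm_nonneg _), ofReal_norm]

/-- Point evaluations are bounded, uniformly on compact subsets of the disk. -/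
theorem exists_bound [hα : Fact (-1 < α)] [CompleteSpace H] {r : ℝ} (hr : r < 1) :
    ∃ C : ℝ, ∀ (f : BergmanSpace α H) (z : unitDisk), ‖(z : ℂ)‖ ≤ r → ‖f z‖ ≤ C * ‖f‖ := by
  have hpi := Real.pi_pos
  have hα' := hα.out
  rcases lt_or_ge r 0 with hr0 | hr0
  · exact ⟨0, fun f z hz => absurd ((norm_nonneg _).trans hz) (by linarith)⟩
  set d : ℂ → ℝ := fun w => (α + 1) * (1 - ‖w‖ ^ 2) ^ α / Real.pi with hd
  set s : ℝ := (1 + r) / 2 with hs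
  set ρ : ℝ := (1 - r) / 2 with hρ
  have hρ0 : 0 < ρ := by linarith
  have hdc : ContinuousOn d (Metric.closedBall 0 s) := by
    refine ContinuousOn.div_const (continuousOn_const.mul (ContinuousOn.rpow_const
      (by fun_prop) (fun w hw => Or.inl ?_))) _
    have hw' : ‖w‖ ≤ s := mem_closedBall_zero_iff.1 hw
    have : ‖w‖ < 1 := by linarith
    nlinarith [norm_nonneg w]
  obtain ⟨w₀, hw₀, hmin⟩ := (isCompact_closedBall (0 : ℂ) s).exists_isMinOn
    ⟨0, by simp only [Metric.mem_closedBall, dist_self]; linarith⟩ hdc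
  set m := d w₀ with hm
  have hm0 : 0 < m := by
    have hw' : ‖w₀‖ ≤ s := mem_closedBall_zero_iff.1 hw₀
    exact density_pos hα' ⟨w₀, mem_ball_zero_iff.2 (by linarith)⟩
  set c : ENNReal :=
    ENNReal.ofReal (ρ / 2) * ENNReal.ofReal (2 * Real.pi) * ENNReal.ofReal (ρ / 2) with hc
  have hc0 : c ≠ 0 := by
    have h1 : 0 < ρ / 2 := by linarith
    have h2 : 0 < 2 * Real.pi := by linarith
    exact mul_ne_zero (mul_ne_zero (ENNReal.ofReal_pos.2 h1).ne' (ENNReal.ofReal_pos.2 h2).ne')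
      (ENNReal.ofReal_pos.2 h1).ne'
  have hct : c ≠ ⊤ := by
    simp only [hc]
    finiteness
  set M : ENNReal := volume (Metric.ball (0 : ℂ) ρ) + (ENNReal.ofReal m)⁻¹ with hM
  have hMt : M ≠ ⊤ := ENNReal.add_ne_top.2
    ⟨measure_ball_lt_top.ne, ENNReal.inv_ne_top.2 (ENNReal.ofReal_pos.2 hm0).ne'⟩
  have key : ∀ (f : BergmanSpace α H) (z : unitDisk), ‖(z : ℂ)‖ ≤ r → ‖f‖ ≤ 1 →
      ‖f z‖ ≤ (M / c).toReal := by
    intro f z hz hf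
    obtain ⟨F, hF, hFf⟩ := f.analytic
    have hsub : Metric.closedBall (z : ℂ) ρ ⊆ Metric.closedBall 0 s := by
      refine Metric.closedBall_subset_closedBall' ?_
      rw [dist_zero_right]
      linarith
    have hsub1 : Metric.closedBall (0 : ℂ) s ⊆ unitDisk :=
      Metric.closedBall_subset_ball (by linarith)
    have h1 := enorm_le_lintegral_ball (F := F) (z := z) (ρ := ρ)
      (hF.differentiableOn.mono (hsub.trans hsub1))
    have hL : ∫⁻ w in unitDisk, ENNReal.ofReal (d w) * ‖F w‖ₑ ^ 2 = ENNReal.ofReal (‖f‖ ^ 2) := by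
      rw [← lintegral_sq_eq, diskMeasure, lintegral_withDensity_eq_lintegral_mul _
        (density_measurable α) (f.analytic.continuous.enorm.measurable.pow_const 2),
        ← lintegral_subtype_comap Metric.isOpen_ball.measurableSet]
      refine lintegral_congr fun w => ?_
      rw [hFf]
      rfl
    have h2 : ENNReal.ofReal m * ∫⁻ w in Metric.ball (z : ℂ) ρ, ‖F w‖ₑ ^ 2 ≤ 1 := by
      calc ENNReal.ofReal m * ∫⁻ w in Metric.ball (z : ℂ) ρ, ‖F w‖ₑ ^ 2
          = ∫⁻ w in Metric.ball (z : ℂ) ρ, ENNReal.ofReal m * ‖F w‖ₑ ^ 2 :=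
            (lintegral_const_mul' _ _ ENNReal.ofReal_ne_top).symm
        _ ≤ ∫⁻ w in Metric.ball (z : ℂ) ρ, ENNReal.ofReal (d w) * ‖F w‖ₑ ^ 2 := by
            refine setLIntegral_mono' Metric.isOpen_ball.measurableSet fun w hw => ?_
            gcongr
            exact hmin (hsub (Metric.ball_subset_closedBall hw))
        _ ≤ ∫⁻ w in unitDisk, ENNReal.ofReal (d w) * ‖F w‖ₑ ^ 2 :=
            lintegral_mono_set (Metric.ball_subset_closedBall.trans (hsub.trans hsub1))
        _ = ENNReal.ofReal (‖f‖ ^ 2) := hL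
        _ ≤ 1 := by
            rw [← ENNReal.ofReal_one]
            exact ENNReal.ofReal_le_ofReal (pow_le_one₀ (norm_nonneg _) hf)
    have h3 : ∫⁻ w in Metric.ball (z : ℂ) ρ, ‖F w‖ₑ ≤ M := by
      calc ∫⁻ w in Metric.ball (z : ℂ) ρ, ‖F w‖ₑ
          ≤ ∫⁻ w in Metric.ball (z : ℂ) ρ, (1 + ‖F w‖ₑ ^ 2) := by
            refine lintegral_mono fun w => ?_
            rcases le_total ‖F w‖ₑ 1 with h | h
            · exact h.trans le_self_add
            · exact (le_self_pow₀ h two_ne_zero).trans le_add_self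
        _ = volume (Metric.ball (z : ℂ) ρ) + ∫⁻ w in Metric.ball (z : ℂ) ρ, ‖F w‖ₑ ^ 2 := by
            rw [lintegral_add_left measurable_const, setLIntegral_one]
        _ ≤ M := by
            rw [hM, Measure.addHaar_ball_center]
            gcongr
            rw [ENNReal.le_inv_iff_mul_le, mul_comm]
            exact h2
    have h4 : ‖f z‖ₑ ≤ M / c := by
      rw [ENNReal.le_div_iff_mul_le (Or.inl hc0) (Or.inl hct), mul_comm, ← hFf]
      exact h1.trans h3
    have h5 := ENNReal.toReal_mono (ENNReal.div_ne_top hMt hc0) h4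
    simpa using h5
  refine ⟨(M / c).toReal, fun f z hz => ?_⟩
  rcases eq_or_ne f 0 with rfl | hf
  · rw [norm_zero, mul_zero]
    exact (norm_zero (E := H)).le
  have hn : 0 < ‖f‖ := norm_pos_iff.2 hf
  have := key (((‖f‖⁻¹ : ℝ) : ℂ) • f) z hz (by
    rw [norm_smul, Complex.norm_real, norm_inv, norm_norm, inv_mul_cancel₀ hn.ne'])
  rw [smul_apply, norm_smul, Complex.norm_real, norm_inv, norm_norm] at this
  rwa [inv_mul_le_iff₀ hn, mul_comm] at this

theorem norm_toLp [Fact (-1 < α)] (f : BergmanSpace α H) : ‖f.memLp.toLp‖ = ‖f‖ := by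
  have h : ‖f.memLp.toLp‖ ^ 2 = ‖f‖ ^ 2 := by
    rw [norm_sq_eq, ← Complex.ofReal_inj, ← integral_inner_self]
    have := inner_self_eq_norm_sq_to_K (𝕜 := ℂ) f.memLp.toLp
    rw [L2.inner_def] at this
    refine Eq.trans ?_ (this.symm.trans (integral_congr_ae ?_))
    · simp
    · filter_upwards [f.memLp.coeFn_toLp] with z hf
      rw [hf]
  exact (sq_eq_sq₀ (norm_nonneg _) (norm_nonneg _)).1 h

instance [Fact (-1 < α)] [CompleteSpace H] : CompleteSpace (BergmanSpace α H) := by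
  refine Metric.complete_of_cauchySeq_tendsto fun u hu => ?_
  have hdist : ∀ f g : BergmanSpace α H, dist f.memLp.toLp g.memLp.toLp = dist f g := by
    intro f g
    rw [dist_eq_norm, dist_eq_norm, ← norm_toLp (f - g)]
    rfl
  have hcu : CauchySeq fun n => (u n).memLp.toLp := by
    rw [Metric.cauchySeq_iff] at hu ⊢
    simpa only [hdist] using hu
  obtain ⟨g, hg⟩ := cauchySeq_tendsto_of_complete hcu
  choose F hF hFf using fun n => (u n).analytic
  have hUC : ∀ r : ℝ, r < 1 → UniformCauchySeqOn F atTop (Metric.closedBall 0 r) := by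
    intro r hr
    obtain ⟨C, hC⟩ := exists_bound (α := α) (H := H) hr
    rw [Metric.uniformCauchySeqOn_iff]
    intro ε hε
    obtain ⟨N, hN⟩ := Metric.cauchySeq_iff.1 hu (ε / (|C| + 1)) (by positivity)
    refine ⟨N, fun m hm n hn w hw => ?_⟩
    have hw' : ‖w‖ ≤ r := mem_closedBall_zero_iff.1 hw
    have h1 := hC (u m - u n) ⟨w, mem_ball_zero_iff.2 (hw'.trans_lt hr)⟩ hw'
    rw [sub_apply, ← hFf, ← hFf, ← dist_eq_norm, ← dist_eq_norm] at h1
    have h2 := hN m hm n hn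
    rw [lt_div_iff₀ (by positivity)] at h2
    have h3 : C * dist (u m) (u n) ≤ |C| * dist (u m) (u n) :=
      mul_le_mul_of_nonneg_right (le_abs_self C) dist_nonneg
    have h4 : 0 ≤ dist (u m) (u n) := dist_nonneg
    change dist (F m w) (F n w) ≤ _ at h1
    linarith
  have hlim : ∀ w ∈ unitDisk, ∃ y, Tendsto (fun n => F n w) atTop (𝓝 y) := fun w hw =>
    cauchySeq_tendsto_of_complete
      ((hUC ‖w‖ (mem_ball_zero_iff.1 hw)).cauchySeq (mem_closedBall_zero_iff.2 le_rfl))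
  choose! G hG using hlim
  have hloc : TendstoLocallyUniformlyOn F G atTop unitDisk := by
    rw [Metric.tendstoLocallyUniformlyOn_iff]
    intro ε hε w hw
    have hw' : ‖w‖ < 1 := mem_ball_zero_iff.1 hw
    have hr : (1 + ‖w‖) / 2 < 1 := by linarith
    refine ⟨Metric.closedBall 0 ((1 + ‖w‖) / 2), mem_nhdsWithin_of_mem_nhds
      (Filter.mem_of_superset (Metric.isOpen_ball.mem_nhds (mem_ball_zero_iff.2
        (by linarith : ‖w‖ < (1 + ‖w‖) / 2))) Metric.ball_subset_closedBall), ?_⟩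
    exact Metric.tendstoUniformlyOn_iff.1 ((hUC _ hr).tendstoUniformlyOn_of_tendsto
      fun y hy => hG y (Metric.closedBall_subset_ball hr hy)) ε hε
  have hGd : DifferentiableOn ℂ G unitDisk :=
    hloc.differentiableOn (Eventually.of_forall fun n => (hF n).differentiableOn)
      Metric.isOpen_ball
  have hGg : (fun z : unitDisk => G z) =ᵐ[diskMeasure α] g := by
    obtain ⟨ns, hns, hae⟩ := (tendstoInMeasure_of_tendsto_Lp hg).exists_seq_tendsto_ae
    have hall : ∀ᵐ z ∂(diskMeasure α), ∀ n, MemLp.toLp (u n) (u n).memLp z = u n z :=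
      ae_all_iff.2 fun n => (u n).memLp.coeFn_toLp
    filter_upwards [hae, hall] with z hz hz'
    refine tendsto_nhds_unique ((hG z z.2).comp hns.tendsto_atTop) (hz.congr fun i => ?_)
    rw [hz', ← hFf]
    rfl
  let f : BergmanSpace α H := ⟨fun z => G z,
    ⟨G, hGd.analyticOnNhd Metric.isOpen_ball, fun z => rfl⟩,
    (memLp_congr_ae hGg).2 (Lp.memLp g)⟩
  have hfg : f.memLp.toLp = g := Lp.ext (f.memLp.coeFn_toLp.trans hGg)
  refine ⟨f, ?_⟩
  rw [tendsto_iff_dist_tendsto_zero] at hg ⊢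
  simpa only [← hfg, hdist] using hg

end Complete

end BergmanSpace

/-! The main tool is a mean value property: rotations preserve the measure, so the integral of `‖z‖
^ n • F z` is a radial moment times `F 0`. Hence the inner product of `z ^ n • h` with `z ^ n • G z`
is a nonzero moment times `⟪h, G 0⟫` (`inner_monomial`). This replaces Taylor expansion: monomials
of different degree are orthogonal, and together they span a dense subspace.

If `Φ z = a * z`, then `C` acts on the degree `n` monomials as the scalar `a ^ n`, so it is diagonal
and therefore normal (`isStarNormal_of_apply_monomial`).

Conversely, an eigenvector of the adjoint of a normal operator is an eigenvector of the operator,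
for the conjugate eigenvalue. Constants are fixed by `C`, hence by its adjoint. Being orthogonal to
`z • h`, they are then orthogonal to its image `Φ z • h`, which forces `Φ 0 = 0`. Now `Φ z = z * Q
z`, and comparing first-order coefficients shows that the adjoint multiplies `z • h` by the
conjugate of `Q 0`. Normality gives `Φ z • h = (Q 0 * z) • h`, so `Φ` is linear. -/

/-! ### Finiteness of the weighted measure -/

theorem integrableOn_mul_one_sub_sq_rpow {α : ℝ} (hα : -1 < α) :
    IntegrableOn (fun y : ℝ => y * (1 - y ^ 2) ^ α) (Set.Ioo 0 1) := by
  have h1 : IntervalIntegrable (fun y : ℝ => (1 - y) ^ α) volume 0 1 := by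
    have h := (intervalIntegral.intervalIntegrable_rpow' (a := 0) (b := 1) hα).comp_sub_left 1
    simpa using h.symm
  -- Factor `1 - y ^ 2 = (1 - y) * (1 + y)`: only `(1 - y) ^ α` can be singular on `[0, 1]`, and it
  -- is integrable because `α > -1`.
  have h2 : IntervalIntegrable (fun y : ℝ => (1 - y) ^ α * (y * (1 + y) ^ α)) volume 0 1 := by
    refine h1.mul_continuousOn (continuousOn_id.mul (ContinuousOn.rpow_const (by fun_prop) ?_))
    intro y hy
    rw [Set.uIcc_of_le zero_le_one] at hy
    left
    linarith [hy.1]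
  rw [intervalIntegrable_iff_integrableOn_Ioo_of_le zero_le_one] at h2
  refine h2.congr_fun (fun y hy => ?_) measurableSet_Ioo
  have e : 1 - y ^ 2 = (1 - y) * (1 + y) := by ring
  dsimp only
  rw [e, Real.mul_rpow (by linarith [hy.2]) (by linarith [hy.1])]
  ring

/-- Polar coordinates reduce this to the preceding radial integral. Finiteness puts bounded analytic
functions, monomials in particular, into the space. -/
theorem isFiniteMeasure_diskMeasure {α : ℝ} (hα : -1 < α) : IsFiniteMeasure (diskMeasure α) := by
  have h : Integrable (fun w : ℂ =>
      (Set.Ioo (0 : ℝ) 1).indicator (fun y => (1 - y ^ 2) ^ α) ‖w‖) volume := by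
    rw [integrable_fun_norm_addHaar volume
      (f := (Set.Ioo (0 : ℝ) 1).indicator (fun y => (1 - y ^ 2) ^ α))]
    have h0 := (integrableOn_mul_one_sub_sq_rpow hα).integrable_indicator measurableSet_Ioo
    refine h0.integrableOn.congr_fun (fun y _ => ?_) measurableSet_Ioi
    by_cases hy : y ∈ Set.Ioo (0 : ℝ) 1 <;> simp [Complex.finrank_real_complex, hy]
  have h' := (h.const_mul ((α + 1) / Real.pi)).lintegral_lt_top
  constructor
  rw [diskMeasure, withDensity_apply _ MeasurableSet.univ, Measure.restrict_univ,
    lintegral_subtype_comap Metric.isOpen_ball.measurableSet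
      (fun z : ℂ => ENNReal.ofReal ((α + 1) * (1 - ‖z‖ ^ 2) ^ α / Real.pi))]
  refine lt_of_le_of_lt ?_ h'
  rw [← lintegral_indicator Metric.isOpen_ball.measurableSet]
  refine lintegral_mono_ae ?_
  -- The radial indicator lives on the open interval `(0, 1)`, so it misses the origin, a null set.
  have : ∀ᵐ w : ℂ, w ≠ 0 := by
    simp [ae_iff]
  filter_upwards [this] with w hw
  by_cases hw1 : w ∈ unitDisk
  · have : ‖w‖ ∈ Set.Ioo (0 : ℝ) 1 := ⟨norm_pos_iff.2 hw, mem_ball_zero_iff.1 hw1⟩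
    rw [Set.indicator_of_mem hw1, Set.indicator_of_mem this]
    apply le_of_eq
    congr 1
    ring
  · simp [Set.indicator_of_notMem hw1]

/-! ### Rotation invariance -/

/-- Multiplication by a number of modulus at most one, as a self-map of the disk. -/
def diskDilation (a : ℂ) (ha : ‖a‖ ≤ 1) (z : unitDisk) : unitDisk :=
  ⟨a * z, mem_ball_zero_iff.2 (by
    rw [norm_mul]
    exact (mul_le_of_le_one_left (norm_nonneg _) ha).trans_lt (mem_ball_zero_iff.1 z.2))⟩

theorem coe_diskDilation (a : ℂ) (ha : ‖a‖ ≤ 1) (z : unitDisk) :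
    (diskDilation a ha z : ℂ) = a * z := rfl

theorem continuous_diskDilation (a : ℂ) (ha : ‖a‖ ≤ 1) : Continuous (diskDilation a ha) :=
  (continuous_const.mul continuous_subtype_val).subtype_mk _

/-- A rotation is a linear isometry of `ℂ`, so it preserves Lebesgue measure; the rest transfers
this to the subtype. -/
theorem measurePreserving_comap_rotation {a : ℂ} (ha : ‖a‖ = 1) :
    MeasurePreserving (diskDilation a ha.le)
      (Measure.comap (fun z : unitDisk => (z : ℂ)) volume)
      (Measure.comap (fun z : unitDisk => (z : ℂ)) volume) := by
  have hm := (continuous_diskDilation a ha.le).measurable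
  refine ⟨hm, Measure.ext fun s hs => ?_⟩
  rw [Measure.map_apply hm hs, measurableEmbedding_disk.comap_apply,
    measurableEmbedding_disk.comap_apply]
  have hR := (rotation ⟨a, mem_sphere_zero_iff_norm.2 ha⟩).measurePreserving
  rw [← hR.measure_preimage (measurableEmbedding_disk.measurableSet_image.2 hs).nullMeasurableSet]
  congr 1
  ext w
  simp only [Set.mem_image, Set.mem_preimage]
  constructor
  · rintro ⟨z, hz, rfl⟩
    exact ⟨_, hz, rfl⟩
  · rintro ⟨z, hz, hzw⟩
    have hw : ‖w‖ < 1 := by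
      have h1 : ‖(z : ℂ)‖ < 1 := mem_ball_zero_iff.1 z.2
      rw [hzw] at h1
      change ‖a * w‖ < 1 at h1
      rwa [norm_mul, ha, one_mul] at h1
    refine ⟨⟨w, mem_ball_zero_iff.2 hw⟩, ?_, rfl⟩
    convert hz using 1
    exact Subtype.ext hzw.symm

theorem measurePreserving_rotation (α : ℝ) {a : ℂ} (ha : ‖a‖ = 1) :
    MeasurePreserving (diskDilation a ha.le) (diskMeasure α) (diskMeasure α) := by
  have h0 := measurePreserving_comap_rotation ha
  refine ⟨h0.measurable, Measure.ext fun s hs => ?_⟩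
  rw [Measure.map_apply h0.measurable hs, diskMeasure,
    withDensity_apply _ (h0.measurable hs), withDensity_apply _ hs,
    ← h0.setLIntegral_comp_preimage hs (density_measurable α)]
  simp [coe_diskDilation, ha]

theorem integral_rotation (α : ℝ) {E : Type*} [NormedAddCommGroup E] [NormedSpace ℝ E]
    {a : ℂ} (ha : ‖a‖ = 1) {g : unitDisk → E} (hg : Continuous g) :
    ∫ z, g (diskDilation a ha.le z) ∂(diskMeasure α) = ∫ z, g z ∂(diskMeasure α) := by
  have h := measurePreserving_rotation α ha
  have := integral_map (μ := diskMeasure α) h.measurable.aemeasurable (f := g)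
    (by rw [h.map_eq]; exact hg.aestronglyMeasurable)
  rw [← this, h.map_eq]

/-! ### The weighted mean value property -/

/-- Circular means of an analytic function. -/
theorem integral_rotation_angle {E : Type*} [NormedAddCommGroup E] [NormedSpace ℂ E]
    [CompleteSpace E] {F : ℂ → E} (hF : AnalyticOnNhd ℂ F unitDisk) (z : unitDisk) :
    ∫ θ in (0 : ℝ)..2 * Real.pi, F (Complex.exp (θ * Complex.I) * z) =
      (2 * Real.pi) • F 0 := by
  have hz : ‖(z : ℂ)‖ < 1 := mem_ball_zero_iff.1 z.2
  have hd : DiffContOnCl ℂ F (Metric.ball 0 |‖(z : ℂ)‖|) := by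
    rw [abs_of_nonneg (norm_nonneg _)]
    refine DifferentiableOn.diffContOnCl_ball (U := unitDisk) hF.differentiableOn ?_
    exact Metric.closedBall_subset_ball hz
  have h2 := hd.circleAverage
  -- Starting the circle at the argument of `z` makes its parametrization equal to `θ ↦ exp (θ * I)
  -- * z`.
  rw [Real.circleAverage_eq_integral_add (Complex.arg z)] at h2
  rw [← h2, smul_smul, mul_inv_cancel₀ (by positivity), one_smul]
  refine intervalIntegral.integral_congr fun θ _ => ?_
  simp only [circleMap, zero_add]
  congr 1
  conv_lhs => rw [← Complex.norm_mul_exp_arg_mul_I (z : ℂ)]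
  push_cast
  rw [add_mul, Complex.exp_add]
  ring

/-- An integral over the disk is the integral of the means over the rotations of the disk. -/
theorem integral_integral_rotation (α : ℝ) [SFinite (diskMeasure α)] {E : Type*}
    [NormedAddCommGroup E] [NormedSpace ℝ E] [CompleteSpace E] {G : unitDisk → E}
    (hG : Continuous G)    (hint : Integrable G (diskMeasure α)) :
    ∫ z, (∫ θ in (0 : ℝ)..2 * Real.pi, G (diskDilation (Complex.exp (θ * Complex.I))
      (Complex.norm_exp_ofReal_mul_I θ).le z)) ∂(diskMeasure α) =
      (2 * Real.pi) • ∫ z, G z ∂(diskMeasure α) := by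
  have hu : ∀ θ : ℝ, ‖Complex.exp (θ * Complex.I)‖ = 1 := Complex.norm_exp_ofReal_mul_I
  set K : ℝ → unitDisk → E := fun θ z => G (diskDilation _ (hu θ).le z) with hK
  have hKc : Continuous (Function.uncurry K) := by
    refine hG.comp (Continuous.subtype_mk ?_ _)
    fun_prop
  have hnorm : ∀ θ : ℝ, ∫ z, ‖K θ z‖ ∂(diskMeasure α) = ∫ z, ‖G z‖ ∂(diskMeasure α) :=
    fun θ => integral_rotation α (hu θ) (g := fun z => ‖G z‖) hG.norm
  -- Fubini applies because the `L¹` norm of `K θ` does not depend on `θ`.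
  have hKi : Integrable (Function.uncurry K)
      ((volume.restrict (Set.uIoc 0 (2 * Real.pi))).prod (diskMeasure α)) := by
    rw [integrable_prod_iff hKc.aestronglyMeasurable]
    constructor
    · refine Eventually.of_forall fun θ => ?_
      exact (measurePreserving_rotation α (hu θ)).integrable_comp_of_integrable hint
    · simp only [Function.uncurry_apply_pair, hnorm]
      have : IsFiniteMeasure (volume.restrict (Set.uIoc 0 (2 * Real.pi))) := by
        unfold Set.uIoc
        infer_instance
      exact integrable_const _
  rw [← intervalIntegral_integral_swap hKi]
  simp only [hK, integral_rotation α (hu _) hG]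
  rw [intervalIntegral.integral_const, sub_zero]

/-- The mean value property with a radial weight. -/
theorem integral_norm_pow_smul (α : ℝ) [SFinite (diskMeasure α)] {E : Type*}
    [NormedAddCommGroup E] [NormedSpace ℂ E] [CompleteSpace E] {F : ℂ → E}
    (hF : AnalyticOnNhd ℂ F unitDisk) (n : ℕ)
    (hint : Integrable (fun z : unitDisk => ‖(z : ℂ)‖ ^ n • F z) (diskMeasure α)) :
    ∫ z : unitDisk, ‖(z : ℂ)‖ ^ n • F z ∂(diskMeasure α) =
      (∫ z : unitDisk, ‖(z : ℂ)‖ ^ n ∂(diskMeasure α)) • F 0 := by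
  have hFc : Continuous fun z : unitDisk => F z := hF.continuousOn.domRestrict
  have hc : Continuous fun z : unitDisk => ‖(z : ℂ)‖ ^ n • F z :=
    (continuous_subtype_val.norm.pow n).smul hFc
  -- Averaging over rotations leaves the radial factor unchanged and replaces `F z` by `(2 * π) • F
  -- 0`.
  have h1 := integral_integral_rotation α hc hint
  simp only [coe_diskDilation, norm_mul, Complex.norm_exp_ofReal_mul_I, one_mul,
    intervalIntegral.integral_smul, integral_rotation_angle hF] at h1
  rw [integral_smul_const, smul_comm] at h1
  exact (smul_right_injective E (by positivity : (2 * Real.pi) ≠ 0) h1).symm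

/-! ### Division by powers of `z` -/

/-- An analytic function on the disk divided by `z`, once its value at `0` is subtracted. -/
theorem exists_eq_add_smul_analytic {E : Type*} [NormedAddCommGroup E] [NormedSpace ℂ E]
    [CompleteSpace E] {F : ℂ → E} (hF : AnalyticOnNhd ℂ F unitDisk) :
    ∃ G : ℂ → E, AnalyticOnNhd ℂ G unitDisk ∧ ∀ z, F z = F 0 + z • G z := by
  refine ⟨dslope F 0, ?_, fun z => ?_⟩
  · refine DifferentiableOn.analyticOnNhd ?_ Metric.isOpen_ball
    rw [Complex.differentiableOn_dslope (Metric.isOpen_ball.mem_nhds (by simp))]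
    exact hF.differentiableOn
  · have := sub_smul_dslope F 0 z
    rw [sub_zero] at this
    rw [this]
    abel

/-- An analytic function on the disk that is divisible by all powers of `z` vanishes. -/
theorem eq_zero_of_forall_eq_pow_smul {E : Type*} [NormedAddCommGroup E] [NormedSpace ℂ E]
    {F : ℂ → E} (hF : AnalyticOnNhd ℂ F unitDisk)
    (h : ∀ n : ℕ, ∃ G : ℂ → E, AnalyticOnNhd ℂ G unitDisk ∧ ∀ z, F z = z ^ n • G z) :
    Set.EqOn F 0 unitDisk := by
  have h0 : (0 : ℂ) ∈ unitDisk := by simp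
  refine hF.eqOn_zero_of_preconnected_of_eventuallyEq_zero
    (convex_ball (0 : ℂ) 1).isPreconnected h0 (analyticOrderAt_eq_top.1 ?_)
  refine ENat.eq_top_iff_forall_ge.2 fun n => ?_
  obtain ⟨G, hG, hFG⟩ := h n
  rw [natCast_le_analyticOrderAt (hF 0 h0)]
  exact ⟨G, hG 0 h0, Eventually.of_forall fun z => by rw [sub_zero, hFG]⟩

/-! ### Monomials: orthogonality and totality -/

namespace BergmanSpace

variable {α : ℝ} {H : Type*} [NormedAddCommGroup H] [InnerProductSpace ℂ H]

theorem memLp_of_bound [hα : Fact (-1 < α)] {f : unitDisk → H} (hf : IsAnalyticOnDisk f) (c : ℝ)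
    (hc : ∀ z, ‖f z‖ ≤ c) : MemLp f 2 (diskMeasure α) :=
  have := isFiniteMeasure_diskMeasure hα.out
  MemLp.of_bound hf.continuous.aestronglyMeasurable c (Eventually.of_forall hc)

/-- The function `z ↦ zⁿ h`. -/
def monomial (α : ℝ) [Fact (-1 < α)] (n : ℕ) (h : H) : BergmanSpace α H :=
  have hf : IsAnalyticOnDisk fun z : unitDisk => (z : ℂ) ^ n • h :=
    ⟨fun z => z ^ n • h, (analyticOnNhd_id.pow n).smul analyticOnNhd_const, fun _ => rfl⟩
  ⟨fun z => (z : ℂ) ^ n • h, hf, memLp_of_bound hf ‖h‖ fun z => by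
    rw [norm_smul, norm_pow]
    exact mul_le_of_le_one_left (norm_nonneg _)
      (pow_le_one₀ (norm_nonneg _) (mem_ball_zero_iff.1 z.2).le)⟩

theorem monomial_apply [Fact (-1 < α)] (n : ℕ) (h : H) (z : unitDisk) :
    monomial α n h z = (z : ℂ) ^ n • h := rfl

/-- The powers of `z` combine to the radial weight `‖z‖ ^ (2 * n)`, so the mean value property
applies to the analytic function `⟪h, G z⟫`. -/
theorem inner_monomial [hα : Fact (-1 < α)] (n : ℕ) (h : H) {f : BergmanSpace α H} {G : ℂ → H}
    (hG : AnalyticOnNhd ℂ G unitDisk) (hf : ∀ z : unitDisk, f z = (z : ℂ) ^ n • G z) :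
    inner ℂ (monomial α n h) f =
      (∫ z : unitDisk, ‖(z : ℂ)‖ ^ (2 * n) ∂(diskMeasure α)) • inner ℂ h (G 0) := by
  have := isFiniteMeasure_diskMeasure hα.out
  have hA : AnalyticOnNhd ℂ (fun z => inner ℂ h (G z)) unitDisk := fun z hz =>
    ((innerSL ℂ h).analyticAt _).comp (hG z hz)
  have he : ∀ z : unitDisk, inner ℂ (monomial α n h z) (f z) =
      ‖(z : ℂ)‖ ^ (2 * n) • inner ℂ h (G z) := fun z => by
    rw [monomial_apply, hf, inner_smul_left, inner_smul_right, ← mul_assoc, Complex.real_smul,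
      mul_comm ((starRingEnd ℂ) _), Complex.mul_conj, Complex.normSq_eq_norm_sq, norm_pow]
    push_cast
    ring
  have hi := integrable_inner (monomial α n h) f
  simp only [he] at hi
  rw [inner_def]
  simp only [he]
  exact integral_norm_pow_smul α hA _ hi

/-- The moment is the squared norm of `z ^ n` in the scalar space `H = ℂ`, and `z ^ n` does not
vanish at `1 / 2`. -/
theorem integral_norm_pow_ne_zero [Fact (-1 < α)] (n : ℕ) :
    ∫ z : unitDisk, ‖(z : ℂ)‖ ^ (2 * n) ∂(diskMeasure α) ≠ 0 := by
  intro h0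
  have h := inner_monomial (α := α) n (1 : ℂ) (f := monomial α n 1) (G := fun _ => 1)
    analyticOnNhd_const (fun z => monomial_apply n 1 z)
  rw [h0, zero_smul, inner_self_eq_zero] at h
  have hz : (1 / 2 : ℂ) ∈ unitDisk := by
    rw [mem_ball_zero_iff]
    norm_num
  have h1 := monomial_apply (α := α) n (1 : ℂ) ⟨1 / 2, hz⟩
  rw [h] at h1
  have h2 : (0 : ℂ) = (1 / 2 : ℂ) ^ n • 1 := h1
  exact pow_ne_zero n (by norm_num : (1 / 2 : ℂ) ≠ 0) (by simpa using h2.symm)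

theorem inner_monomial_of_lt [Fact (-1 < α)] {m n : ℕ} (hmn : m < n) (h k : H) :
    inner ℂ (monomial α m h) (monomial α n k) = 0 := by
  rw [inner_monomial m h (G := fun z => z ^ (n - m) • k)
    ((analyticOnNhd_id.pow _).smul analyticOnNhd_const) (fun z => by
      rw [monomial_apply, smul_smul, ← pow_add, Nat.add_sub_cancel' hmn.le])]
  simp [zero_pow (Nat.sub_pos_of_lt hmn).ne']

theorem inner_monomial_of_ne [Fact (-1 < α)] {m n : ℕ} (hmn : m ≠ n) (h k : H) :
    inner ℂ (monomial α m h) (monomial α n k) = 0 := by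
  rcases hmn.lt_or_gt with hlt | hlt
  · exact inner_monomial_of_lt hlt h k
  · rw [← inner_conj_symm, inner_monomial_of_lt hlt, map_zero]

/-- If `f = z ^ n • G`, testing against `z ^ n • G 0` gives `‖G 0‖ ^ 2 = 0`, so another factor `z`
splits off. By induction every power of `z` divides `f`. -/
theorem eq_zero_of_inner_monomial [CompleteSpace H] [Fact (-1 < α)] {f : BergmanSpace α H}
    (hf : ∀ (n : ℕ) (h : H), inner ℂ (monomial α n h) f = 0) : f = 0 := by
  obtain ⟨F, hF, hFf⟩ := f.analytic
  have key : ∀ n : ℕ, ∃ G : ℂ → H, AnalyticOnNhd ℂ G unitDisk ∧ ∀ z, F z = z ^ n • G z := by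
    intro n
    induction n with
    | zero => exact ⟨F, hF, fun z => by simp⟩
    | succ n ih =>
      obtain ⟨G, hG, hFG⟩ := ih
      have h0 := hf n (G 0)
      rw [inner_monomial n (G 0) hG (fun z => by rw [← hFf, hFG]), smul_eq_zero] at h0
      have hG0 : G 0 = 0 := inner_self_eq_zero.1 (h0.resolve_left (integral_norm_pow_ne_zero n))
      obtain ⟨G', hG', hGG'⟩ := exists_eq_add_smul_analytic hG
      exact ⟨G', hG', fun z => by rw [hFG, hGG', hG0, zero_add, smul_smul, pow_succ]⟩
  apply DFunLike.ext
  intro z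
  rw [← hFf]
  exact eq_zero_of_forall_eq_pow_smul hF key z.2

theorem dense_span_monomial [CompleteSpace H] [Fact (-1 < α)] :
    Dense (Submodule.span ℂ (Set.range fun p : ℕ × H => monomial α p.1 p.2) :
      Set (BergmanSpace α H)) := by
  rw [Submodule.dense_iff_topologicalClosure_eq_top, Submodule.topologicalClosure_eq_top_iff,
    Submodule.eq_bot_iff]
  intro f hf
  exact eq_zero_of_inner_monomial fun n h =>
    hf _ (Submodule.subset_span ⟨(n, h), rfl⟩)

/-! ### Dilations are bounded and normal -/

/-- For `‖a‖ = 1` rotation invariance gives an isometry. For `‖a‖ < 1` only values on the disk of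
radius `‖a‖` matter; there point evaluations are uniformly bounded, and the measure is finite. -/
theorem exists_dilation [CompleteSpace H] [hα : Fact (-1 < α)] (a : ℂ) (ha : ‖a‖ ≤ 1) :
    ∃ C : BergmanSpace α H →L[ℂ] BergmanSpace α H,
      ∀ (f : BergmanSpace α H) (z : unitDisk), C f z = f (diskDilation a ha z) := by
  have hfin := isFiniteMeasure_diskMeasure hα.out
  have han : ∀ f : BergmanSpace α H, IsAnalyticOnDisk fun z => f (diskDilation a ha z) := by
    intro f
    obtain ⟨F, hF, hFf⟩ := f.analytic
    refine ⟨fun z => F (a * z), fun z hz => ?_, fun z => hFf (diskDilation a ha z)⟩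
    exact (hF (a * z) (diskDilation a ha ⟨z, hz⟩).2).comp
      (analyticAt_const.mul analyticAt_id)
  have hbd : ∃ c : ℝ, ∀ f : BergmanSpace α H,
      MemLp (fun z => f (diskDilation a ha z)) 2 (diskMeasure α) ∧
      ∫ z, ‖f (diskDilation a ha z)‖ ^ 2 ∂(diskMeasure α) ≤ (c * ‖f‖) ^ 2 := by
    rcases ha.lt_or_eq with hlt | heq
    · obtain ⟨c, hc⟩ := exists_bound (α := α) (H := H) hlt
      have hb : ∀ (f : BergmanSpace α H) (z : unitDisk),
          ‖f (diskDilation a ha z)‖ ≤ c * ‖f‖ := fun f z => hc f _ (by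
        rw [coe_diskDilation, norm_mul]
        exact mul_le_of_le_one_right (norm_nonneg _) (mem_ball_zero_iff.1 z.2).le)
      refine ⟨√((diskMeasure α).real Set.univ) * c, fun f => ?_⟩
      have hm := memLp_of_bound (α := α) (han f) _ (hb f)
      refine ⟨hm, ?_⟩
      calc ∫ z, ‖f (diskDilation a ha z)‖ ^ 2 ∂(diskMeasure α)
          ≤ ∫ _, (c * ‖f‖) ^ 2 ∂(diskMeasure α) :=
            integral_mono ((memLp_two_iff_integrable_sq_norm hm.1).1 hm) (integrable_const _)
              fun z => pow_le_pow_left₀ (norm_nonneg _) (hb f z) 2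
        _ = (√((diskMeasure α).real Set.univ) * c * ‖f‖) ^ 2 := by
            rw [integral_const, smul_eq_mul, mul_assoc, mul_pow (√_), Real.sq_sqrt measureReal_nonneg]
    · refine ⟨1, fun f => ⟨f.memLp.comp_measurePreserving (measurePreserving_rotation α heq), ?_⟩⟩
      rw [integral_rotation α heq (g := fun z => ‖f z‖ ^ 2) (f.analytic.continuous.norm.pow 2),
        one_mul, norm_sq_eq]
  obtain ⟨c, hc⟩ := hbd
  let L : BergmanSpace α H →ₗ[ℂ] BergmanSpace α H :=
    { toFun := fun f => ⟨fun z => f (diskDilation a ha z), han f, (hc f).1⟩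
      map_add' := fun f g => rfl
      map_smul' := fun b f => rfl }
  refine ⟨L.mkContinuous |c| fun f => ?_, fun f z => rfl⟩
  have h1 : ‖L f‖ ^ 2 ≤ (|c| * ‖f‖) ^ 2 := by
    rw [norm_sq_eq, mul_pow, sq_abs, ← mul_pow]
    exact (hc f).2
  exact (sq_le_sq₀ (norm_nonneg _) (by positivity)).1 h1

-- Orthogonality of the eigenvectors makes the adjoint diagonal too, with conjugate eigenvalues. The
-- two products then agree on a dense span.
open ContinuousLinearMap in
theorem isStarNormal_of_apply_monomial [CompleteSpace H] [Fact (-1 < α)]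
    {C : BergmanSpace α H →L[ℂ] BergmanSpace α H} {a : ℕ → ℂ}
    (hC : ∀ (n : ℕ) (h : H), C (monomial α n h) = a n • monomial α n h) : IsStarNormal C := by
  have hadj : ∀ (n : ℕ) (h : H),
      adjoint C (monomial α n h) = (starRingEnd ℂ) (a n) • monomial α n h := by
    intro n h
    rw [← sub_eq_zero]
    refine eq_zero_of_inner_monomial fun m k => ?_
    rw [inner_sub_right, adjoint_inner_right, hC, inner_smul_left, inner_smul_right, ← sub_mul]
    rcases eq_or_ne m n with rfl | hmn
    · rw [sub_self, zero_mul]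
    · rw [inner_monomial_of_ne hmn, mul_zero]
  refine ⟨ContinuousLinearMap.ext_on dense_span_monomial ?_⟩
  rintro _ ⟨⟨n, h⟩, rfl⟩
  simp only [star_eq_adjoint, mul_apply_eq_comp, hC, hadj, map_smul]
  exact smul_comm _ _ _

-- The operator `C - a • 1` is normal, and a normal operator has the same kernel as its adjoint.
open ContinuousLinearMap in
theorem apply_eq_smul_of_adjoint_apply_eq_smul {E : Type*} [NormedAddCommGroup E]
    [InnerProductSpace ℂ E] [CompleteSpace E] {C : E →L[ℂ] E} (hC : IsStarNormal C) {a : ℂ}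
    {x : E} (h : adjoint C x = (starRingEnd ℂ) a • x) : C x = a • x := by
  have hN : IsStarNormal (C - a • (1 : E →L[ℂ] E)) := by
    have h1 : IsStarNormal (a • (1 : E →L[ℂ] E)) := inferInstance
    rw [isStarNormal_iff] at hC ⊢
    rw [star_sub, star_smul, star_one]
    refine Commute.sub_left (Commute.sub_right hC ?_) ?_
    · exact (Commute.one_right _).smul_right _
    · exact ((Commute.one_left _).smul_left _)
  have h0 := (IsStarNormal.adjoint_apply_eq_zero_iff hN x).1 (by
    rw [← star_eq_adjoint, star_sub, star_smul, star_one, star_eq_adjoint]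
    simp [h])
  simpa [sub_eq_zero] using h0

/-! ### Consequences of normality for the symbol -/

section Composition

variable [Fact (-1 < α)] {Φ : unitDisk → unitDisk} {C : BergmanSpace α H →L[ℂ] BergmanSpace α H}

theorem comp_monomial_zero (hC : ∀ (f : BergmanSpace α H) (z : unitDisk), C f z = f (Φ z))
    (h : H) : C (monomial α 0 h) = monomial α 0 h :=
  DFunLike.ext _ _ fun z => by simp [hC, monomial_apply]

open ContinuousLinearMap in
/-- The symbol of a normal composition operator fixes the origin. -/
theorem symbol_zero [CompleteSpace H] [Nontrivial H] (hN : IsStarNormal C)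
    (hC : ∀ (f : BergmanSpace α H) (z : unitDisk), C f z = f (Φ z))
    {P : ℂ → ℂ} (hP : AnalyticOnNhd ℂ P unitDisk) (hPΦ : ∀ z : unitDisk, P z = Φ z) :
    P 0 = 0 := by
  obtain ⟨h, hh⟩ := exists_ne (0 : H)
  have hN' : IsStarNormal (adjoint C) := by
    rw [← star_eq_adjoint]
    infer_instance
  -- The eigenvector lemma is applied to `adjoint C`, whose adjoint is `C`, with eigenvalue `1`.
  have h1 : adjoint C (monomial α 0 h) = monomial α 0 h := by
    have := apply_eq_smul_of_adjoint_apply_eq_smul hN' (a := 1) (x := monomial α 0 h) (by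
      rw [adjoint_adjoint, comp_monomial_zero hC, map_one, one_smul])
    rwa [one_smul] at this
  have h2 : inner ℂ (monomial α 0 h) (C (monomial α 1 h)) = 0 := by
    rw [← adjoint_inner_left, h1, inner_monomial_of_ne zero_ne_one]
  rw [inner_monomial 0 h (G := fun z => P z • h) (hP.smul analyticOnNhd_const) (fun z => by
    simp [hC, monomial_apply, hPΦ])] at h2
  have h3 := (smul_eq_zero.1 h2).resolve_left (integral_norm_pow_ne_zero 0)
  rw [inner_smul_right] at h3
  exact (mul_eq_zero.1 h3).resolve_right (inner_self_ne_zero.2 hh)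

open ContinuousLinearMap in
/-- If the symbol is `z ↦ z P(z)`, then the adjoint acts on `z ↦ z h` as a scalar. -/
theorem adjoint_monomial_one [CompleteSpace H]
    (hC : ∀ (f : BergmanSpace α H) (z : unitDisk), C f z = f (Φ z))
    {P : ℂ → ℂ} (hP : AnalyticOnNhd ℂ P unitDisk) (hPΦ : ∀ z : unitDisk, (Φ z : ℂ) = z * P z)
    (h : H) : adjoint C (monomial α 1 h) = (starRingEnd ℂ) (P 0) • monomial α 1 h := by
  refine ext_inner_right ℂ fun f => ?_
  obtain ⟨F, hF, hFf⟩ := f.analytic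
  obtain ⟨G, hG, hFG⟩ := exists_eq_add_smul_analytic hF
  -- The constant term is fixed by `C` and orthogonal to `z • h`, so it contributes to neither inner
  -- product.
  set g := f - monomial α 0 (F 0) with hg
  have hgG : ∀ z : unitDisk, g z = (z : ℂ) ^ 1 • G z := fun z => by
    rw [hg, sub_apply, ← hFf, hFG, monomial_apply]
    simp
  -- This function is `C g` divided by `z`; its value at `0` is `P 0 • G 0`, which produces the
  -- scalar.
  have hGP : AnalyticOnNhd ℂ (fun z => P z • G (z * P z)) unitDisk := fun z hz => by
    refine (hP z hz).smul (AnalyticAt.comp (g := G) (f := fun z => z * P z) (hG _ ?_)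
      (analyticAt_id.mul (hP z hz)))
    rw [← hPΦ ⟨z, hz⟩]
    exact (Φ ⟨z, hz⟩).2
  have hfg : f = g + monomial α 0 (F 0) := by rw [hg, sub_add_cancel]
  have h1 : inner ℂ (monomial α 1 h) f = inner ℂ (monomial α 1 h) g := by
    rw [hfg, inner_add_right, inner_monomial_of_ne one_ne_zero, add_zero]
  have h2 : inner ℂ (monomial α 1 h) (C f) = inner ℂ (monomial α 1 h) (C g) := by
    rw [hfg, map_add, inner_add_right, comp_monomial_zero hC,
      inner_monomial_of_ne one_ne_zero, add_zero]
  rw [adjoint_inner_left, inner_smul_left, Complex.conj_conj, h1, h2, inner_monomial 1 h hG hgG,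
    inner_monomial 1 h hGP (fun z => by rw [hC, hgG, hPΦ, pow_one, pow_one, smul_smul]),
    zero_mul, inner_smul_right, mul_smul_comm]

end Composition

end BergmanSpace

theorem norm_le_one_of_mul_mem_unitDisk {a : ℂ} (h : ∀ z ∈ unitDisk, a * z ∈ unitDisk) :
    ‖a‖ ≤ 1 := by
  by_contra! ha
  have h0 : a ≠ 0 := norm_pos_iff.1 (by linarith)
  -- If `‖a‖ > 1`, the point `a⁻¹` of the disk would be sent to `1`.
  have := h a⁻¹ (mem_ball_zero_iff.2 (by rw [norm_inv]; exact inv_lt_one_of_one_lt₀ ha))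
  rw [mul_inv_cancel₀ h0] at this
  simp at this

/-! ### The characterization -/

theorem mainTheorem5 {H : Type*} [NormedAddCommGroup H] [InnerProductSpace ℂ H] [CompleteSpace H]
    [TopologicalSpace.SeparableSpace H] [Nontrivial H] (α : ℝ) [Fact (-1 < α)]
    (Φ : unitDisk → unitDisk) (hΦ : IsAnalyticOnDisk (fun z => (Φ z : ℂ))) :
    (∃ C : BergmanSpace α H →L[ℂ] BergmanSpace α H,
        (∀ (f : BergmanSpace α H) (z : unitDisk), C f z = f (Φ z)) ∧ IsStarNormal C) ↔
      ∃ lam : ℂ, ‖lam‖ ≤ 1 ∧ ∀ z : unitDisk, (Φ z : ℂ) = lam * z := by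
  constructor
  · rintro ⟨C, hC, hN⟩
    obtain ⟨P, hP, hPΦ⟩ := hΦ
    dsimp only at hPΦ
    obtain ⟨Q, hQ, hPQ⟩ := exists_eq_add_smul_analytic hP
    have hQΦ : ∀ z : unitDisk, (Φ z : ℂ) = z * Q z := fun z => by
      rw [← hPΦ, hPQ, BergmanSpace.symbol_zero hN hC hP hPΦ, zero_add, smul_eq_mul]
    obtain ⟨h, hh⟩ := exists_ne (0 : H)
    -- The eigenvector equation for `z • h`, evaluated pointwise, determines `Φ` after cancelling `h
    -- ≠ 0`.
    have hlin : ∀ z : unitDisk, (Φ z : ℂ) = Q 0 * z := fun z => by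
      have h1 := BergmanSpace.apply_eq_smul_of_adjoint_apply_eq_smul hN
        (BergmanSpace.adjoint_monomial_one hC hQ hQΦ h)
      have h2 := congrArg (fun f : BergmanSpace α H => f z) h1
      simp only [hC, BergmanSpace.smul_apply, BergmanSpace.monomial_apply, pow_one,
        smul_smul] at h2
      exact smul_left_injective ℂ hh h2
    refine ⟨Q 0, norm_le_one_of_mul_mem_unitDisk fun z hz => ?_, hlin⟩
    rw [← hlin ⟨z, hz⟩]
    exact (Φ ⟨z, hz⟩).2
  · rintro ⟨a, ha, hΦa⟩
    obtain ⟨C, hC⟩ := BergmanSpace.exists_dilation (α := α) (H := H) a ha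
    refine ⟨C, fun f z => ?_, BergmanSpace.isStarNormal_of_apply_monomial (a := fun n => a ^ n)
      fun n h => DFunLike.ext _ _ fun z => ?_⟩
    · rw [hC]
      exact congrArg f (Subtype.ext (hΦa z).symm)
    · rw [hC, BergmanSpace.smul_apply, BergmanSpace.monomial_apply, BergmanSpace.monomial_apply,
        coe_diskDilation, mul_pow, smul_smul]
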